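/- Let $H,U$ be separable real Hilbert spaces, $(\tilde\varphi_i)_{i}$ a (finite or countably infinite) orthonormal basis of $U$, and $(\Omega,\mathcal F,\mathbb P)$ an atomless probability space, where $\Omega$ is Polish and $\mathcal F$ is its Borel $\sigma$-field. Let $\mathcal P_2(H)$ be the set of Borel probability measures on $H$ with finite second moment, with the 2-Wasserstein distance $W_2$. Let $E$ be $U$ or $\mathbb R$. The lift of $f:\mathcal P_2(H)\to E$ is $\hat f:L^2(\Omega,H)\to E$, $\hat f(X)=f(\mathcal L(X))$. The map $f$ is *L-differentiable at* $\mu_0$ if $\hat f$ is Fréchet differentiable at some $X_0$ with law $\mu_0$. It is *absolutely continuous L-differentiable* if $\hat f$ is Fréchet differentiable on $L^2(\Omega,H)$, $|||D\hat f(X)|||_{2}<\infty$ for all $X$, and $X\mapsto D\hat f(X)$ is continuous with respect to $|||\cdot|||_{2}$, where for bounded linear $L:L^2(\Omega,H)\to E$ $$|||L|||_{2}=\sup\Big\{\sum_{i=1}^n\|L(\mathbf 1_{A_i}x_i)\|_E:\ n\in\mathbb N,\ A_i\in\mathcal F\text{ disjoint},\ x_i\in H,\ \mathbb E\Big[\Big\|\sum_{i=1}^n\mathbf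 1_{A_i}x_i\Big\|_H^2\Big]\le1\Big\}.$$ The *regular L-derivative* $\partial_\mu f(\mu_0)\in L^2(H,\mu_0;L(H,E))$ is the class with $D\hat f(X)Y=\mathbb E[\partial_\mu f(\mu_0)(X)Y]$ for all $X\in L^2(\Omega,H)$ with law $\mu_0$ and all $Y\in L^2(\Omega,H)$. For $E=\mathbb R$ its values are identified with elements of $H$ by the Riesz isomorphism. The map $f$ is in $\mathcal C^2(\mathcal P_2(H),E)$ if it is absolutely continuous L-differentiable, $(\mu,y)\mapsto\partial_\mu f(\mu)(y)$ has a jointly continuous version on $\mathcal P_2(H)\times H$, and this version is Fréchet differentiable in $y$ with jointly continuous derivative $\partial_y\partial_\mu f(\mu)(y)\in L(H,L(H,E))$. **Lemma 3.3.** Let $f:\mathcal P_2(H)\to U$ be absolutely continuous L-differentiable, and for $v\in U$ let $f_v(\mu)=\langle f(\mu),v\rangle_U$; write $f_i=f_{\tilde\varphi_i}$. Then: 1. For every $v\in U$, $f_v$ is L-differentiable at every $\mu_0\in\mathcal P_2(H)$, and it is absolutely continuous L-differentiable. The regular L-derivatives $\partial_\mu f(\mu_0)$ and $\partial_\mu f_v(\mu_0)$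 exist for all $\mu_0\in\mathcal P_2(H)$ and $v\in U$. 2. For every $\mu_0\in\mathcal P_2(H)$ and $v\in U$, $\partial_\mu f_v(\mu_0)(y)=\partial_\mu f(\mu_0)(y)^*v$ for $\mu_0$-almost every $y\in H$. 3. For every $\mu_0\in\mathcal P_2(H)$ and $\mu_0$-almost every $y\in H$, we have for all $w\in H$ that $\langle\partial_\mu f_i(\mu_0)(y),w\rangle_H=\langle\tilde\varphi_i,\partial_\mu f(\mu_0)(y)w\rangle_U$ for all $i$, and $$\sum_{i}\langle\partial_\mu f_i(\mu_0)(y),w\rangle_H\,\tilde\varphi_i=\partial_\mu f(\mu_0)(y)w,$$ where the series converges (unconditionally) in $U$. 4. If $f\in\mathcal C^2(\mathcal P_2(H),U)$, then for every $v\in U$, $f_v\in\mathcal C^2(\mathcal P_2(H),\mathbb R)$ and $$\partial_y\partial_\mu f_v(\mu)(y)z=\big((\partial_y\partial_\mu f(\mu)(y))z\big)^*v\qquad\text{for all }\mu\in\mathcal P_2(H),\ y,z\in H.$$ -/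

import Mathlib

open MeasureTheory Filter Topology
open scoped ENNReal InnerProductSpace

noncomputable section

/-- The set of Borel probability measures on `H` with finite second moment. -/
def P2 (H : Type*) [NormedAddCommGroup H] [MeasurableSpace H] : Type _ :=
  {μ : Measure H // IsProbabilityMeasure μ ∧ ∫⁻ x, ‖x‖ₑ ^ 2 ∂μ < ∞}

/-- The 2-Wasserstein distance: the infimum runs over all couplings of `μ` and `ν`. -/
def W2 {H : Type*} [NormedAddCommGroup H] [MeasurableSpace H] (μ ν : P2 H) : ℝ≥0∞ :=
  (⨅ (π : Measure (H × H)) (_ : π.map Prod.fst = μ.1) (_ : π.map Prod.snd = ν.1),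
    ∫⁻ p, ‖p.1 - p.2‖ₑ ^ 2 ∂π) ^ (1 / 2 : ℝ)

/-- Joint continuity of `(μ, y) ↦ G μ y` on the product of the metric spaces `(P2 H, W2)`
and `H`. -/
def JointlyContinuous {H E : Type*} [NormedAddCommGroup H] [MeasurableSpace H]
    [NormedAddCommGroup E] (G : P2 H → H → E) : Prop :=
  ∀ (μ : P2 H) (y : H), ∀ ε > 0, ∃ δ > 0, ∀ (ν : P2 H) (z : H),
    W2 ν μ < ENNReal.ofReal δ → ‖z - y‖ < δ → ‖G ν z - G μ y‖ < ε

/-- The law of a square integrable random variable. -/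
def lawP2 {Ω H : Type*} [MeasurableSpace Ω] (P : Measure Ω) [IsProbabilityMeasure P]
    [NormedAddCommGroup H] [MeasurableSpace H] [BorelSpace H] (X : Lp H 2 P) : P2 H :=
  ⟨P.map X, by
    have hm : AEMeasurable X P := (Lp.aestronglyMeasurable X).aemeasurable
    refine ⟨Measure.isProbabilityMeasure_map hm, ?_⟩
    rw [lintegral_map' (by fun_prop) hm]
    have h := (Lp.memLp X).eLpNorm_lt_top
    rw [eLpNorm_lt_top_iff_lintegral_rpow_enorm_lt_top (by norm_num) (by norm_num)] at h
    simpa using h⟩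

/-- The lift `X ↦ f (lawP2 X)` of `f` to `L²(Ω, H)`. -/
def lionsLift {Ω H U : Type*} [MeasurableSpace Ω] (P : Measure Ω) [IsProbabilityMeasure P]
    [NormedAddCommGroup H] [MeasurableSpace H] [BorelSpace H]
    (f : P2 H → U) (X : Lp H 2 P) : U :=
  f (lawP2 P X)

/-- `f` is L-differentiable at `μ₀`: the lift is Fréchet differentiable at some random variable
with law `μ₀`. -/
def LDifferentiableAt {Ω H U : Type*} [MeasurableSpace Ω] (P : Measure Ω) [IsProbabilityMeasure P]
    [NormedAddCommGroup H] [InnerProductSpace ℝ H] [MeasurableSpace H] [BorelSpace H]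
    [NormedAddCommGroup U] [InnerProductSpace ℝ U] (f : P2 H → U) (μ₀ : P2 H) : Prop :=
  ∃ X₀ : Lp H 2 P, lawP2 P X₀ = μ₀ ∧ DifferentiableAt ℝ (lionsLift P f) X₀

/-- The 2-variation norm of a bounded linear operator `L²(Ω, H) → U`. The supremum runs over all
step functions `Y = ∑ i, 1_{A i} x i` with disjoint measurable sets `A i` and `E ‖Y‖² ≤ 1`. -/
def twoVariation {Ω H U : Type*} [MeasurableSpace Ω] (P : Measure Ω) [IsProbabilityMeasure P]
    [NormedAddCommGroup H] [InnerProductSpace ℝ H]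
    [NormedAddCommGroup U] [InnerProductSpace ℝ U] (L : Lp H 2 P →L[ℝ] U) : ℝ≥0∞ :=
  ⨆ (n : ℕ) (A : Fin n → Set Ω) (x : Fin n → H) (hA : ∀ i, MeasurableSet (A i))
    (_ : Pairwise fun i j => Disjoint (A i) (A j))
    (_ : ∫⁻ ω, ‖∑ i, (A i).indicator (fun _ => x i) ω‖ₑ ^ 2 ∂P ≤ 1),
    ∑ i, ‖L (indicatorConstLp 2 (hA i) (measure_ne_top P (A i)) (x i))‖ₑ

/-- `Λ`-continuous Fréchet differentiability: the derivative takes values in the operators of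
finite 2-variation norm and is continuous with respect to that norm. -/
def LambdaContDiff {Ω H U : Type*} [MeasurableSpace Ω] (P : Measure Ω) [IsProbabilityMeasure P]
    [NormedAddCommGroup H] [InnerProductSpace ℝ H]
    [NormedAddCommGroup U] [InnerProductSpace ℝ U] (F : Lp H 2 P → U) : Prop :=
  Differentiable ℝ F ∧
  (∀ X, twoVariation P (fderiv ℝ F X) < ∞) ∧
  ∀ X, Tendsto (fun X' => twoVariation P (fderiv ℝ F X' - fderiv ℝ F X)) (𝓝 X) (𝓝 0)

/-- `f` is absolutely continuous L-differentiable. -/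
def AbsContLDiff {Ω H U : Type*} [MeasurableSpace Ω] (P : Measure Ω) [IsProbabilityMeasure P]
    [NormedAddCommGroup H] [InnerProductSpace ℝ H] [MeasurableSpace H] [BorelSpace H]
    [NormedAddCommGroup U] [InnerProductSpace ℝ U] (f : P2 H → U) : Prop :=
  LambdaContDiff P (lionsLift P f)

/-- The class `g ∈ L²(H, μ; L(H, U))` represents the derivative of the lift of `f`:
`D(lionsLift f)(X) Y = E[g(X) Y]` for all `X` with law `μ` and all `Y ∈ L²(Ω, H)`. -/
def IsRegularLDeriv {Ω H U : Type*} [MeasurableSpace Ω] (P : Measure Ω) [IsProbabilityMeasure P]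
    [NormedAddCommGroup H] [InnerProductSpace ℝ H] [MeasurableSpace H] [BorelSpace H]
    [NormedAddCommGroup U] [InnerProductSpace ℝ U] (f : P2 H → U) (μ : P2 H)
    (g : Lp (H →L[ℝ] U) 2 μ.1) : Prop :=
  ∀ X : Lp H 2 P, lawP2 P X = μ → DifferentiableAt ℝ (lionsLift P f) X ∧
    ∀ Y : Lp H 2 P, Integrable (fun ω => g (X ω) (Y ω)) P ∧
      fderiv ℝ (lionsLift P f) X Y = ∫ ω, g (X ω) (Y ω) ∂P

open Classical in
/-- The regular L-derivative `∂_μ f(μ) ∈ L²(H, μ; L(H, U))`, that is the class representing the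
derivative of the lift (`0` if there is none). -/
def regularLDeriv {Ω H U : Type*} [MeasurableSpace Ω] (P : Measure Ω) [IsProbabilityMeasure P]
    [NormedAddCommGroup H] [InnerProductSpace ℝ H] [MeasurableSpace H] [BorelSpace H]
    [NormedAddCommGroup U] [InnerProductSpace ℝ U] (f : P2 H → U) (μ : P2 H) :
    Lp (H →L[ℝ] U) 2 μ.1 :=
  if h : ∃ g, IsRegularLDeriv P f μ g then h.choose else 0

/-- `f` is in `C²(P2 H, U)` and `G` is the jointly continuous version of
`(μ, y) ↦ ∂_μ f(μ)(y)`; then `∂_y ∂_μ f(μ)(y)` is `fderiv ℝ (G μ) y`. -/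
structure IsC2Version {Ω H U : Type*} [MeasurableSpace Ω] (P : Measure Ω) [IsProbabilityMeasure P]
    [NormedAddCommGroup H] [InnerProductSpace ℝ H] [MeasurableSpace H] [BorelSpace H]
    [NormedAddCommGroup U] [InnerProductSpace ℝ U] (f : P2 H → U)
    (G : P2 H → H → H →L[ℝ] U) : Prop where
  absContLDiff : AbsContLDiff P f
  version : ∀ μ : P2 H, ∀ᵐ y ∂μ.1, G μ y = regularLDeriv P f μ y
  continuous : JointlyContinuous G
  differentiable : ∀ μ : P2 H, Differentiable ℝ (G μ)
  continuous_deriv : JointlyContinuous fun μ y => fderiv ℝ (G μ) y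

/-- The class `C²(P2 H, U)`. -/
def IsC2 {Ω H U : Type*} [MeasurableSpace Ω] (P : Measure Ω) [IsProbabilityMeasure P]
    [NormedAddCommGroup H] [InnerProductSpace ℝ H] [MeasurableSpace H] [BorelSpace H]
    [NormedAddCommGroup U] [InnerProductSpace ℝ U] (f : P2 H → U) : Prop :=
  ∃ G, IsC2Version P f G

/-- The scalar projection `f_v = ⟨f, v⟩`. -/
def scalarProj {H U : Type*} [NormedAddCommGroup H] [MeasurableSpace H]
    [NormedAddCommGroup U] [InnerProductSpace ℝ U] (f : P2 H → U) (v : U) : P2 H → ℝ :=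
  fun μ => ⟪f μ, v⟫_ℝ

/-- The Riesz representative of a bounded linear functional on `H`. -/
def riesz {H : Type*} [NormedAddCommGroup H] [InnerProductSpace ℝ H] [CompleteSpace H]
    (l : H →L[ℝ] ℝ) : H :=
  (InnerProductSpace.toDual ℝ H).symm l

end

/-! The heart of the matter is that `D(lionsLift f)(X)` has a density of the form `g(X)` with `g`
depending only on the law of `X`. Everything else is composition with the bounded functional `⟪v,
·⟫` and uniqueness of the density.

Let `s` be a simple function on `H`. On a fibre of `s(X)` the variable is constant, so the law of
`s(X) + t 1_C x`, with `C` inside the fibre, depends on `C` only through `P C`. Hence so does the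
derivative in direction `1_C x`. It is also additive in `C`, and on an atomless space this forces
proportionality to `P C` (`measureReal_smul_eq_of_additive`). The derivative at `s(X)` therefore has
a density `m(s(X))` (`exists_fderiv_lionsLift_simpleFunc`).

Now let simple functions `s n` approximate the identity in `L²(μ)`. The 2-variation norm dominates
the `L²` norm of simple densities (`eLpNorm_simpleFunc_le_twoVariation`), so continuity of the
derivative in that norm makes the densities Cauchy in `L²(H, μ; L(H, U))`. Their limit is the
regular L-derivative (`exists_isRegularLDeriv`). No Radon-Nikodym theorem for vector measures is
involved.

Testing on `1_{X ∈ A} x` shows that the class is unique, which gives the adjoint formula almost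
everywhere; the series is then the expansion in the Hilbert basis. For `C²` maps the formula holds
at every point, because a jointly continuous version is determined everywhere, even off the support
of `μ` (`IsC2Version.unique`). -/

/-! ### Atomless spaces: uniform variables, prescribed laws, sets of prescribed measure. -/

/-- The distribution function of a finite measure without atoms is continuous. -/
theorem continuous_cdf_of_nullSingletonClass (ν : Measure ℝ) [IsProbabilityMeasure ν]
    [NullSingletonClass ν] : Continuous (ProbabilityTheory.cdf ν) := by
  rw [continuous_iff_continuousAt]
  intro x
  set F := ProbabilityTheory.cdf ν
  have h : F.measure {x} = 0 := by rw [ProbabilityTheory.measure_cdf]; exact measure_singleton x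
  rw [StieltjesFunction.measure_singleton, ENNReal.ofReal_eq_zero] at h
  have hl : Function.leftLim F x = F x :=
    le_antisymm (F.mono.leftLim_le le_rfl) (sub_nonpos.1 h)
  rw [continuousAt_iff_continuous_left'_right']
  exact ⟨F.mono.continuousWithinAt_Iio_iff_leftLim_eq.2 hl,
    (F.right_continuous x).mono Set.Ioi_subset_Ici_self⟩

/-- Probability integral transform: embed `Ω` in `ℝ` and apply the distribution function `F` of the
image law. Since `F` is continuous it attains every level `t` in `(0, 1)`, which gives `P (u < t) ≤
t ≤ P (u ≤ t)`; letting levels decrease to `t` turns this into equality. -/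
theorem exists_measurable_map_eq_volume_unitInterval {Ω : Type*} [MeasurableSpace Ω]
    [StandardBorelSpace Ω] (P : Measure Ω) [IsProbabilityMeasure P] [NullSingletonClass P] :
    ∃ u : Ω → unitInterval, Measurable u ∧ P.map u = volume := by
  have he := measurableEmbedding_embeddingReal Ω
  set e := embeddingReal Ω with he_def
  have : IsProbabilityMeasure (P.map e) := Measure.isProbabilityMeasure_map he.measurable.aemeasurable
  have : NullSingletonClass (P.map e) := ⟨fun x => by
    rw [Measure.map_apply he.measurable (measurableSet_singleton x)]
    exact (Set.subsingleton_singleton.preimage he.injective).measure_zero P⟩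
  set F := ProbabilityTheory.cdf (P.map e) with hF
  have hcont : Continuous F := continuous_cdf_of_nullSingletonClass _
  have hFe (x : ℝ) : P {ω | e ω ≤ x} = ENNReal.ofReal (F x) := by
    rw [hF, ProbabilityTheory.ofReal_cdf, Measure.map_apply he.measurable measurableSet_Iic]; rfl
  let u : Ω → unitInterval := fun ω =>
    ⟨F (e ω), ProbabilityTheory.cdf_nonneg _ _, ProbabilityTheory.cdf_le_one _ _⟩
  have hu : Measurable u := (hcont.measurable.comp he.measurable).subtype_mk
  have h1 (t : unitInterval) (h0 : 0 < t) (h1 : t < 1) :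
      P {ω | u ω < t} ≤ ENNReal.ofReal t ∧ ENNReal.ofReal t ≤ P {ω | u ω ≤ t} := by
    have h0' : (0 : ℝ) < t := h0
    have h1' : (t : ℝ) < 1 := h1
    obtain ⟨a, ha⟩ := ((ProbabilityTheory.tendsto_cdf_atBot (P.map e)).eventually_lt_const h0').exists
    obtain ⟨b, hb⟩ := ((ProbabilityTheory.tendsto_cdf_atTop (P.map e)).eventually_const_lt h1').exists
    obtain ⟨x, hx⟩ := mem_range_of_exists_le_of_exists_ge hcont ⟨a, ha.le⟩ ⟨b, hb.le⟩
    rw [← hx, ← hFe]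
    constructor
    · refine measure_mono fun ω hω => ?_
      have hω' : F (e ω) < F x := by rw [hx]; exact hω
      exact ((ProbabilityTheory.monotone_cdf _).reflect_lt hω').le
    · refine measure_mono fun ω hω => ?_
      have : F (e ω) ≤ F x := ProbabilityTheory.monotone_cdf _ hω
      rw [hx] at this
      exact this
  refine ⟨u, hu, ?_⟩
  have : IsProbabilityMeasure (P.map u) := Measure.isProbabilityMeasure_map hu.aemeasurable
  refine Measure.ext_of_Iic _ _ fun t => ?_
  rw [unitInterval.volume_Iic, Measure.map_apply hu measurableSet_Iic]
  change P {ω | u ω ≤ t} = _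
  rcases eq_or_ne t 1 with rfl | ht1
  · simp [unitInterval.le_one']
  have ht1' : t < 1 := lt_of_le_of_ne unitInterval.le_one' ht1
  refine le_antisymm ?_ ?_
  · have : (𝓝[>] t).NeBot := nhdsGT_neBot_of_exists_gt ⟨1, ht1'⟩
    have hlim : Tendsto (fun s : unitInterval => ENNReal.ofReal s) (𝓝[>] t)
        (𝓝 (ENNReal.ofReal t)) :=
      ((ENNReal.continuous_ofReal.comp continuous_subtype_val).tendsto t).mono_left
        nhdsWithin_le_nhds
    refine ge_of_tendsto hlim (eventually_nhdsWithin_of_forall fun s hs => ?_)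
    rcases eq_or_ne s 1 with rfl | hs1
    · simpa using prob_le_one
    · refine le_trans (measure_mono fun ω hω => ?_)
        (h1 s (lt_of_le_of_lt unitInterval.nonneg' (Set.mem_Ioi.1 hs))
          (lt_of_le_of_ne unitInterval.le_one' hs1)).1
      exact lt_of_le_of_lt (show u ω ≤ t from hω) (Set.mem_Ioi.1 hs)
  · rcases eq_or_ne t 0 with rfl | ht0
    · simp
    exact (h1 t (lt_of_le_of_ne unitInterval.nonneg' ht0.symm) ht1').2

theorem exists_lawP2_eq {Ω H : Type*} [MeasurableSpace Ω]
    [StandardBorelSpace Ω] (P : Measure Ω) [IsProbabilityMeasure P] [NullSingletonClass P]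
    [NormedAddCommGroup H] [CompleteSpace H]
    [SecondCountableTopology H] [MeasurableSpace H] [BorelSpace H] (μ : P2 H) :
    ∃ X : Lp H 2 P, lawP2 P X = μ := by
  obtain ⟨u, hu, hPu⟩ := exists_measurable_map_eq_volume_unitInterval P
  have := μ.2.1
  obtain ⟨q, hq, hqμ⟩ := Measure.exists_measurable_map_eq μ.1
  have hqu : P.map (q ∘ u) = μ.1 := by rw [← Measure.map_map hq hu, hPu, hqμ]
  have hmem : MemLp (q ∘ u) 2 P := by
    refine ⟨(hq.comp hu).aestronglyMeasurable, ?_⟩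
    rw [eLpNorm_lt_top_iff_lintegral_rpow_enorm_lt_top (by norm_num) (by norm_num)]
    have h := μ.2.2
    rw [← hqu, lintegral_map (by fun_prop) (hq.comp hu)] at h
    simpa using h
  refine ⟨hmem.toLp, Subtype.ext ?_⟩
  change P.map _ = μ.1
  rw [← hqu]
  exact Measure.map_congr hmem.coeFn_toLp

/-- Intermediate value theorem for `s ↦ P (A ∩ {u ≤ s})` with `u` uniform; this function is
1-Lipschitz and rises from `0` to `P A`. -/
theorem exists_measurableSet_subset_measure_eq {Ω : Type*} [MeasurableSpace Ω]
    [StandardBorelSpace Ω] (P : Measure Ω) [IsProbabilityMeasure P] [NullSingletonClass P]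
    {A : Set Ω} (hA : MeasurableSet A) {t : ℝ≥0∞} (ht : t ≤ P A) :
    ∃ B ⊆ A, MeasurableSet B ∧ P B = t := by
  obtain ⟨u, hu, hPu⟩ := exists_measurable_map_eq_volume_unitInterval P
  have hm (s : unitInterval) : MeasurableSet (A ∩ u ⁻¹' Set.Iic s) := hA.inter (hu measurableSet_Iic)
  have hlip : LipschitzWith 1 fun s : unitInterval => P.real (A ∩ u ⁻¹' Set.Iic s) := by
    refine LipschitzWith.of_le_add fun s r => ?_
    have hsub : A ∩ u ⁻¹' Set.Iic s ⊆ (A ∩ u ⁻¹' Set.Iic r) ∪ u ⁻¹' Set.Ioc r s := by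
      intro ω hω
      by_cases h : u ω ≤ r
      · exact Or.inl ⟨hω.1, h⟩
      · exact Or.inr ⟨not_le.1 h, hω.2⟩
    refine (measureReal_mono hsub).trans ((measureReal_union_le _ _).trans ?_)
    gcongr
    rw [← map_measureReal_apply hu measurableSet_Ioc, hPu, measureReal_def,
      unitInterval.volume_Ioc]
    rw [Subtype.dist_eq, Real.dist_eq]
    exact ENNReal.toReal_le_of_le_ofReal (abs_nonneg _) (ENNReal.ofReal_le_ofReal (le_abs_self _))
  have ht' : t ≠ ∞ := (ht.trans_lt (measure_lt_top P A)).ne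
  obtain ⟨s, hs⟩ := mem_range_of_exists_le_of_exists_ge hlip.continuous (c := t.toReal)
    ⟨0, by
      refine le_trans ?_ ENNReal.toReal_nonneg
      refine (measureReal_mono Set.inter_subset_right).trans ?_
      rw [← map_measureReal_apply hu measurableSet_Iic, hPu, measureReal_def,
        unitInterval.volume_Iic]
      simp⟩
    ⟨1, by
      have : A ∩ u ⁻¹' Set.Iic 1 = A := by
        ext ω; simp [unitInterval.le_one']
      simp only [this]
      exact ENNReal.toReal_mono (measure_ne_top P A) ht⟩
  refine ⟨_, Set.inter_subset_left, hm s, ?_⟩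
  exact (ENNReal.toReal_eq_toReal_iff' (measure_ne_top _ _) ht').1 hs

/-- A finitely additive bounded set function which depends only on the measure of its argument
is proportional to the measure. -/
theorem measureReal_smul_eq_of_additive {Ω E : Type*} [MeasurableSpace Ω]
    [StandardBorelSpace Ω] (P : Measure Ω) [IsProbabilityMeasure P] [NullSingletonClass P]
    [NormedAddCommGroup E] [NormedSpace ℝ E] {A : Set Ω} (hA : MeasurableSet A) (m : Set Ω → E)
    (hadd : ∀ C C', MeasurableSet C → MeasurableSet C' → Disjoint C C' →
      m (C ∪ C') = m C + m C')
    (K : ℝ) (hK : ∀ C, MeasurableSet C → ‖m C‖ ≤ K)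
    (hm : ∀ C ⊆ A, ∀ C' ⊆ A, MeasurableSet C → MeasurableSet C' → P C = P C' → m C = m C')
    {C : Set Ω} (hC : MeasurableSet C) (hCA : C ⊆ A) :
    P.real A • m C = P.real C • m A := by
  set ψ : Set Ω → E := fun C => P.real A • m C - P.real C • m A with hψ
  have hψadd : ∀ C C', MeasurableSet C → MeasurableSet C' → Disjoint C C' →
      ψ (C ∪ C') = ψ C + ψ C' := fun C C' hC hC' hd => by
    simp only [hψ, hadd C C' hC hC' hd,
      measureReal_union hd hC' (measure_ne_top P C) (measure_ne_top P C'), smul_add, add_smul]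
    abel
  have hψm : ∀ C ⊆ A, ∀ C' ⊆ A, MeasurableSet C → MeasurableSet C' → P C = P C' →
      ψ C = ψ C' := fun C hCA C' hCA' hC hC' h => by
    simp only [hψ, hm C hCA C' hCA' hC hC' h, measureReal_def, h]
  have hψA : ψ A = 0 := sub_self _
  -- Halving argument. If `C` has at most half the mass of `A`, there is a disjoint copy `D ⊆ A \ C`
  -- of equal measure, so `2 ψ C = ψ (C ∪ D)` and any uniform bound on `ψ` improves by a factor 2.
  -- Larger sets reduce to their complement in `A` because `ψ A = 0`.
  have hbound : ∀ n : ℕ, ∀ C ⊆ A, MeasurableSet C → ‖ψ C‖ ≤ (K + K) * (1 / 2) ^ n := by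
    intro n
    induction n with
    | zero =>
      intro C _ hC
      have h1 : ∀ B C : Set Ω, MeasurableSet C → ‖P.real B • m C‖ ≤ K := fun B C hC => by
        rw [norm_smul, Real.norm_of_nonneg measureReal_nonneg]
        exact (mul_le_of_le_one_left (norm_nonneg _) measureReal_le_one).trans (hK C hC)
      simpa using (norm_sub_le _ _).trans (add_le_add (h1 A C hC) (h1 C A hA))
    | succ n ih =>
      have half : ∀ C ⊆ A, MeasurableSet C → P C ≤ P (A \ C) →
          ‖ψ C‖ ≤ (K + K) * (1 / 2) ^ (n + 1) := by
        intro C hCA hC hle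
        obtain ⟨D, hDA, hD, hPD⟩ := exists_measurableSet_subset_measure_eq P (hA.diff hC) hle
        have hdisj : Disjoint C D := Set.disjoint_sdiff_right.mono_right hDA
        have hDA' : D ⊆ A := hDA.trans Set.sdiff_subset
        have h := ih (C ∪ D) (Set.union_subset hCA hDA') (hC.union hD)
        rw [hψadd C D hC hD hdisj, hψm D hDA' C hCA hD hC hPD, ← two_smul ℝ, norm_smul] at h
        norm_num at h
        rw [pow_succ]
        linarith
      intro C hCA hC
      rcases le_total (P C) (P (A \ C)) with h | h
      · exact half C hCA hC h
      · have h0 : ψ C = - ψ (A \ C) := by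
          rw [eq_neg_iff_add_eq_zero, ← hψadd _ _ hC (hA.diff hC) Set.disjoint_sdiff_right,
            Set.union_sdiff_cancel hCA, hψA]
        rw [h0, norm_neg]
        refine half _ Set.sdiff_subset (hA.diff hC) ?_
        rwa [Set.sdiff_sdiff_cancel_left hCA]
  have hlim : Tendsto (fun n : ℕ => (K + K) * (1 / 2 : ℝ) ^ n) atTop (𝓝 0) := by
    simpa using (tendsto_pow_atTop_nhds_zero_of_lt_one (by norm_num : (0 : ℝ) ≤ 1 / 2)
      (by norm_num)).const_mul (K + K)
  have h0 : ‖ψ C‖ ≤ 0 := ge_of_tendsto' hlim fun n => hbound n C hCA hC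
  exact sub_eq_zero.1 (norm_le_zero_iff.1 h0)

/-! ### Step functions `1_C x` in `L²`. -/

section Indicator

variable {Ω H : Type*} [MeasurableSpace Ω] (P : Measure Ω) [IsProbabilityMeasure P]
  [NormedAddCommGroup H] [NormedSpace ℝ H]

theorem norm_indicatorConstLp_le_norm {Ω H : Type*} [MeasurableSpace Ω] (P : Measure Ω)
    [IsProbabilityMeasure P] [NormedAddCommGroup H] {C : Set Ω} (hC : MeasurableSet C) (x : H) :
    ‖indicatorConstLp 2 hC (measure_ne_top P C) x‖ ≤ ‖x‖ := by
  refine (norm_indicatorConstLp_le (hs := hC) (hμs := measure_ne_top P C)).trans ?_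
  refine mul_le_of_le_one_right (norm_nonneg x) ?_
  exact Real.rpow_le_one measureReal_nonneg measureReal_le_one (by positivity)

/-- The step function `1_C x` in `L²`, as a continuous linear map of `x`. -/
noncomputable def indicatorConstLpCLM {C : Set Ω} (hC : MeasurableSet C) : H →L[ℝ] Lp H 2 P :=
  LinearMap.mkContinuous
    { toFun := fun x => indicatorConstLp 2 hC (measure_ne_top P C) x
      map_add' := fun x y => indicatorConstLp_add.symm
      map_smul' := fun t x => by
        refine Lp.ext ?_
        filter_upwards [indicatorConstLp_coeFn (p := 2) (hs := hC) (hμs := measure_ne_top P C)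
          (c := t • x), Lp.coeFn_smul t (indicatorConstLp 2 hC (measure_ne_top P C) x),
          indicatorConstLp_coeFn (p := 2) (hs := hC) (hμs := measure_ne_top P C) (c := x)]
          with ω h1 h2 h3
        rw [h1, RingHom.id_apply, h2, Pi.smul_apply, h3, Set.indicator_const_smul_apply] }
    1 fun x => by simpa using norm_indicatorConstLp_le_norm P hC x

theorem indicatorConstLpCLM_apply {C : Set Ω} (hC : MeasurableSet C) (x : H) :
    indicatorConstLpCLM P hC x = indicatorConstLp 2 hC (measure_ne_top P C) x := rfl

theorem norm_indicatorConstLpCLM_apply_le {C : Set Ω} (hC : MeasurableSet C) (x : H) :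
    ‖indicatorConstLpCLM P hC x‖ ≤ ‖x‖ :=
  norm_indicatorConstLp_le_norm P hC x

theorem indicatorConstLpCLM_union {C C' : Set Ω} (hC : MeasurableSet C) (hC' : MeasurableSet C')
    (hd : Disjoint C C') (x : H) :
    indicatorConstLpCLM P (hC.union hC') x =
      indicatorConstLpCLM P hC x + indicatorConstLpCLM P hC' x := by
  simp only [indicatorConstLpCLM_apply]
  exact indicatorConstLp_disjoint_union hC hC' (measure_ne_top P C) (measure_ne_top P C') hd x

theorem indicatorConstLpCLM_eq_zero {C : Set Ω} (hC : MeasurableSet C) (h0 : P C = 0) (x : H) :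
    indicatorConstLpCLM P hC x = 0 := by
  rw [← norm_eq_zero, indicatorConstLpCLM_apply,
    norm_indicatorConstLp (by norm_num) (by norm_num), measureReal_def, h0]
  simp

end Indicator

/-! ### Laws of perturbed variables and derivatives along step functions. -/

theorem measurePreserving_of_lawP2_eq {Ω H : Type*} [MeasurableSpace Ω]
    (P : Measure Ω) [IsProbabilityMeasure P] [NormedAddCommGroup H] [MeasurableSpace H]
    [BorelSpace H] {X : Lp H 2 P} {μ : P2 H} (h : lawP2 P X = μ) :
    MeasurePreserving X P μ.1 :=
  ⟨(Lp.stronglyMeasurable X).measurable, congrArg Subtype.val h⟩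

section Law

variable {Ω H U : Type*} [MeasurableSpace Ω] (P : Measure Ω) [IsProbabilityMeasure P]
  [NormedAddCommGroup H] [InnerProductSpace ℝ H]
  [MeasurableSpace H] [BorelSpace H]
  [NormedAddCommGroup U] [InnerProductSpace ℝ U]

/-- Adding `1_C x` moves mass `P C` from `y` to `y + x`. The moved masses appear as summands on both
sides since measures cannot be subtracted; being finite, they can be cancelled later. -/
theorem map_add_indicatorConstLp (X : Lp H 2 P) {C : Set Ω} (hC : MeasurableSet C) {y : H}
    (hX : ∀ᵐ ω ∂P, ω ∈ C → X ω = y) (x : H) :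
    P.map (X + indicatorConstLpCLM P hC x : Lp H 2 P) + P C • Measure.dirac y =
      P.map X + P C • Measure.dirac (y + x) := by
  have hind := indicatorConstLp_coeFn (p := 2) (hs := hC) (hμs := measure_ne_top P C) (c := x)
  have hadd := Lp.coeFn_add X (indicatorConstLpCLM P hC x)
  have hin : (X + indicatorConstLpCLM P hC x : Lp H 2 P) =ᵐ[P.restrict C] fun _ => y + x := by
    rw [EventuallyEq, ae_restrict_iff' hC]
    filter_upwards [hind, hadd, hX] with ω h1 h2 h3 hω
    rw [h2, Pi.add_apply, indicatorConstLpCLM_apply, h1, h3 hω, Set.indicator_of_mem hω]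
  have hin' : X =ᵐ[P.restrict C] fun _ => y := by
    rw [EventuallyEq, ae_restrict_iff' hC]; exact hX
  have hout : (X + indicatorConstLpCLM P hC x : Lp H 2 P) =ᵐ[P.restrict Cᶜ] X := by
    rw [EventuallyEq, ae_restrict_iff' hC.compl]
    filter_upwards [hind, hadd] with ω h1 h2 hω
    rw [h2, Pi.add_apply, indicatorConstLpCLM_apply, h1, Set.indicator_of_notMem hω, add_zero]
  have key (Z : Lp H 2 P) : P.map Z = (P.restrict C).map Z + (P.restrict Cᶜ).map Z := by
    rw [← Measure.map_add _ _ (Lp.stronglyMeasurable Z).measurable,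
      Measure.restrict_add_restrict_compl hC]
  rw [key X, key (X + _), Measure.map_congr hin, Measure.map_congr hin', Measure.map_congr hout,
    Measure.map_const, Measure.map_const, Measure.restrict_apply_univ]
  abel

theorem lawP2_add_indicatorConstLp_eq {X X' : Lp H 2 P} (hXX' : lawP2 P X = lawP2 P X')
    {C C' : Set Ω} (hC : MeasurableSet C) (hC' : MeasurableSet C') (hCC' : P C = P C') {y : H}
    (hX : ∀ᵐ ω ∂P, ω ∈ C → X ω = y) (hX' : ∀ᵐ ω ∂P, ω ∈ C' → X' ω = y) (x : H) :
    lawP2 P (X + indicatorConstLpCLM P hC x) = lawP2 P (X' + indicatorConstLpCLM P hC' x) := by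
  have h : P.map X = P.map X' := congrArg Subtype.val hXX'
  have h1 := map_add_indicatorConstLp P X hC hX x
  have h2 := map_add_indicatorConstLp P X' hC' hX' x
  rw [h, hCC', ← h2] at h1
  refine Subtype.ext (Measure.ext fun S hS => ?_)
  have h3 := congrArg (fun ν : Measure H => ν S) h1
  simp only [Measure.add_apply] at h3
  refine (ENNReal.add_left_inj ?_).1 h3
  rw [Measure.smul_apply, smul_eq_mul]
  exact ENNReal.mul_ne_top (measure_ne_top _ _) (measure_ne_top _ _)

/-- The derivative of a lift in direction `1_C x`, where `X` is constant on `C`, depends only on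
the law of `X`, the value of `X` on `C`, and the measure of `C`. -/
theorem fderiv_lionsLift_indicator_eq {f : P2 H → U} (hf : Differentiable ℝ (lionsLift P f))
    {X X' : Lp H 2 P} (hXX' : lawP2 P X = lawP2 P X')
    {C C' : Set Ω} (hC : MeasurableSet C) (hC' : MeasurableSet C') (hCC' : P C = P C') {y : H}
    (hX : ∀ᵐ ω ∂P, ω ∈ C → X ω = y) (hX' : ∀ᵐ ω ∂P, ω ∈ C' → X' ω = y) (x : H) :
    fderiv ℝ (lionsLift P f) X (indicatorConstLpCLM P hC x) =
      fderiv ℝ (lionsLift P f) X' (indicatorConstLpCLM P hC' x) := by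
  -- The two lifts coincide along the whole lines `X + t 1_C x` and `X' + t 1_C' x`, hence so do
  -- their directional derivatives.
  rw [← (hf X).lineDeriv_eq_fderiv, ← (hf X').lineDeriv_eq_fderiv, lineDeriv, lineDeriv]
  congr 1
  funext t
  rw [← map_smul, ← map_smul]
  exact congrArg f (lawP2_add_indicatorConstLp_eq P hXX' hC hC' hCC' hX hX' (t • x))

/-- At a simple function of `X`, the derivative of a lift is represented by a function which
depends only on the law of `X`. -/
theorem exists_fderiv_lionsLift_simpleFunc [StandardBorelSpace Ω] [NullSingletonClass P]
    [CompleteSpace H] [SecondCountableTopology H] {f : P2 H → U} (hf : Differentiable ℝ (lionsLift P f)) (μ : P2 H)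
    (s : SimpleFunc H H) (S : Lp H 2 μ.1) (hS : S =ᵐ[μ.1] s) :
    ∃ m : H → H →L[ℝ] U, ∀ (X : Lp H 2 P) (hX : lawP2 P X = μ) (y : H) (C : Set Ω)
      (hC : MeasurableSet C), C ⊆ X ⁻¹' (s ⁻¹' {y}) → ∀ x : H,
      fderiv ℝ (lionsLift P f)
        (Lp.compMeasurePreserving X (measurePreserving_of_lawP2_eq P hX) S)
        (indicatorConstLpCLM P hC x) = P.real C • m y x := by
  obtain ⟨X₀, hX₀⟩ := exists_lawP2_eq P μ
  have hcomp (X : Lp H 2 P) (hX : lawP2 P X = μ) :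
      Lp.compMeasurePreserving X (measurePreserving_of_lawP2_eq P hX) S =ᵐ[P] s ∘ X :=
    (Lp.coeFn_compMeasurePreserving S _).trans
      ((measurePreserving_of_lawP2_eq P hX).quasiMeasurePreserving.ae_eq_comp hS)
  have hval (X : Lp H 2 P) (hX : lawP2 P X = μ) (y : H) (C : Set Ω)
      (hCX : C ⊆ X ⁻¹' (s ⁻¹' {y})) : ∀ᵐ ω ∂P, ω ∈ C →
      Lp.compMeasurePreserving X (measurePreserving_of_lawP2_eq P hX) S ω = y := by
    filter_upwards [hcomp X hX] with ω h hω
    rw [h]; exact hCX hω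
  have hlaw (X : Lp H 2 P) (hX : lawP2 P X = μ) :
      lawP2 P (Lp.compMeasurePreserving X (measurePreserving_of_lawP2_eq P hX) S) =
      lawP2 P (Lp.compMeasurePreserving X₀ (measurePreserving_of_lawP2_eq P hX₀) S) := by
    refine Subtype.ext ?_
    change P.map _ = P.map _
    rw [Measure.map_congr (hcomp X hX), Measure.map_congr (hcomp X₀ hX₀),
      ← Measure.map_map s.measurable (measurePreserving_of_lawP2_eq P hX).measurable,
      ← Measure.map_map s.measurable (measurePreserving_of_lawP2_eq P hX₀).measurable,
      (measurePreserving_of_lawP2_eq P hX).map_eq, (measurePreserving_of_lawP2_eq P hX₀).map_eq]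
  have hA (X : Lp H 2 P) (y : H) : MeasurableSet (X ⁻¹' (s ⁻¹' {y})) :=
    (Lp.stronglyMeasurable X).measurable (s.measurableSet_preimage _)
  -- The density is read off on the full fibre of one reference variable `X₀`, which makes it
  -- independent of `X`. On a null fibre the inverse is `0`, and both sides of the claim vanish
  -- there.
  refine ⟨fun y => (P.real (X₀ ⁻¹' (s ⁻¹' {y})))⁻¹ • (fderiv ℝ (lionsLift P f)
        (Lp.compMeasurePreserving X₀ (measurePreserving_of_lawP2_eq P hX₀) S)).comp
          (indicatorConstLpCLM P (hA X₀ y)), fun X hX y C hC hCX x => ?_⟩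
  set L := fderiv ℝ (lionsLift P f)
    (Lp.compMeasurePreserving X (measurePreserving_of_lawP2_eq P hX) S) with hL
  have hPA : P (X ⁻¹' (s ⁻¹' {y})) = P (X₀ ⁻¹' (s ⁻¹' {y})) := by
    rw [(measurePreserving_of_lawP2_eq P hX).measure_preimage
        (s.measurableSet_preimage _).nullMeasurableSet,
      (measurePreserving_of_lawP2_eq P hX₀).measure_preimage
        (s.measurableSet_preimage _).nullMeasurableSet]
  have h0 := fderiv_lionsLift_indicator_eq P hf (hlaw X hX) (hA X y) (hA X₀ y) hPA
    (hval X hX y _ subset_rfl) (hval X₀ hX₀ y _ subset_rfl) x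
  rw [smul_apply, ContinuousLinearMap.comp_apply, ← h0, ← hL, measureReal_def P (_ ⁻¹' _), ← hPA,
    ← measureReal_def]
  set A := X ⁻¹' (s ⁻¹' {y}) with hA_def
  by_cases hPA0 : P.real A = 0
  · have hC0 : P C = 0 :=
      measure_mono_null hCX ((measureReal_eq_zero_iff (measure_ne_top P A)).1 hPA0)
    rw [indicatorConstLpCLM_eq_zero P hC hC0, map_zero, measureReal_def, hC0]
    simp
  classical
  let m : Set Ω → U := fun B =>
    if hB : MeasurableSet B then L (indicatorConstLpCLM P hB x) else 0
  have hmB {B : Set Ω} (hB : MeasurableSet B) : m B = L (indicatorConstLpCLM P hB x) :=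
    dif_pos hB
  have key := measureReal_smul_eq_of_additive P (hA X y) m
    (fun B B' hB hB' hd => by
      rw [hmB hB, hmB hB', hmB (hB.union hB'), indicatorConstLpCLM_union P hB hB' hd, map_add])
    (‖L‖ * ‖x‖)
    (fun B hB => by
      rw [hmB hB]
      exact L.le_opNorm_of_le (norm_indicatorConstLpCLM_apply_le P hB x))
    (fun B hBA B' hBA' hB hB' hBB' => by
      rw [hmB hB, hmB hB']
      exact fderiv_lionsLift_indicator_eq P hf rfl hB hB' hBB' (hval X hX y B hBA)
        (hval X hX y B' hBA') x)
    hC hCX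
  rw [hmB hC, hmB (hA X y)] at key
  rw [smul_comm, ← key, inv_smul_smul₀ hPA0]

end Law

/-! ### The 2-variation norm. -/

section TwoVariation

variable {Ω H U V : Type*} [MeasurableSpace Ω] (P : Measure Ω) [IsProbabilityMeasure P]
  [NormedAddCommGroup H] [InnerProductSpace ℝ H]
  [NormedAddCommGroup U] [InnerProductSpace ℝ U]
  [NormedAddCommGroup V] [InnerProductSpace ℝ V]

theorem sum_enorm_le_twoVariation (L : Lp H 2 P →L[ℝ] U) {n : ℕ} {A : Fin n → Set Ω}
    {x : Fin n → H} (hA : ∀ i, MeasurableSet (A i))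
    (hd : Pairwise fun i j => Disjoint (A i) (A j))
    (h1 : ∫⁻ ω, ‖∑ i, (A i).indicator (fun _ => x i) ω‖ₑ ^ 2 ∂P ≤ 1) :
    ∑ i, ‖L (indicatorConstLpCLM P (hA i) (x i))‖ₑ ≤ twoVariation P L :=
  le_iSup_of_le n <| le_iSup_of_le A <| le_iSup_of_le x <| le_iSup_of_le hA <|
    le_iSup_of_le hd <| le_iSup_of_le h1 le_rfl

theorem twoVariation_le (L : Lp H 2 P →L[ℝ] U) {K : ℝ≥0∞}
    (h : ∀ (n : ℕ) (A : Fin n → Set Ω) (x : Fin n → H) (hA : ∀ i, MeasurableSet (A i)),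
      (Pairwise fun i j => Disjoint (A i) (A j)) →
      ∫⁻ ω, ‖∑ i, (A i).indicator (fun _ => x i) ω‖ₑ ^ 2 ∂P ≤ 1 →
      ∑ i, ‖L (indicatorConstLpCLM P (hA i) (x i))‖ₑ ≤ K) :
    twoVariation P L ≤ K :=
  iSup_le fun n => iSup_le fun A => iSup_le fun x => iSup_le fun hA => iSup_le fun hd =>
    iSup_le fun h1 => h n A x hA hd h1

theorem twoVariation_add_le (L M : Lp H 2 P →L[ℝ] U) :
    twoVariation P (L + M) ≤ twoVariation P L + twoVariation P M := by
  refine twoVariation_le P _ fun n A x hA hd h1 => ?_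
  refine le_trans (Finset.sum_le_sum fun i _ => enorm_add_le _ _) ?_
  rw [Finset.sum_add_distrib]
  exact add_le_add (sum_enorm_le_twoVariation P L hA hd h1)
    (sum_enorm_le_twoVariation P M hA hd h1)

theorem twoVariation_sub_comm (L M : Lp H 2 P →L[ℝ] U) :
    twoVariation P (L - M) = twoVariation P (M - L) := by
  have h (L M : Lp H 2 P →L[ℝ] U) : twoVariation P (L - M) ≤ twoVariation P (M - L) :=
    twoVariation_le P _ fun n A x hA hd h1 => by
      refine le_trans (le_of_eq ?_) (sum_enorm_le_twoVariation P (M - L) hA hd h1)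
      refine Finset.sum_congr rfl fun i _ => ?_
      rw [← neg_sub M L, neg_apply, enorm_neg]
  exact le_antisymm (h L M) (h M L)

theorem twoVariation_comp_le (B : U →L[ℝ] V) (L : Lp H 2 P →L[ℝ] U) :
    twoVariation P (B.comp L) ≤ ‖B‖ₑ * twoVariation P L := by
  refine twoVariation_le P _ fun n A x hA hd h1 => ?_
  refine le_trans (Finset.sum_le_sum fun i _ => B.le_opENorm _) ?_
  rw [← Finset.mul_sum]
  gcongr
  exact sum_enorm_le_twoVariation P L hA hd h1

theorem enorm_apply_indicator_le_twoVariation (L : Lp H 2 P →L[ℝ] U) {C : Set Ω}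
    (hC : MeasurableSet C) {x : H} (hx : ‖x‖ ≤ 1) :
    ‖L (indicatorConstLpCLM P hC x)‖ₑ ≤ twoVariation P L := by
  have h := sum_enorm_le_twoVariation P L (n := 1) (A := fun _ => C) (x := fun _ => x)
    (fun _ => hC) (fun i j hij => (hij (Subsingleton.elim i j)).elim) ?_
  · simpa using h
  · calc ∫⁻ ω, ‖∑ _i : Fin 1, C.indicator (fun _ => x) ω‖ₑ ^ 2 ∂P ≤ ∫⁻ _, 1 ∂P := by
          refine lintegral_mono fun ω => ?_
          have : ‖C.indicator (fun _ => x) ω‖ₑ ≤ 1 := by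
            refine le_trans (enorm_indicator_le_enorm_self _ _) ?_
            rwa [← ofReal_norm, ENNReal.ofReal_le_one]
          simpa using pow_le_one₀ zero_le this
      _ = 1 := by simp

/-- Reindexes the supremum, taken over `Fin n` families, by the values of a simple function, whose
fibres are the disjoint sets. -/
theorem sum_range_enorm_le_twoVariation {E : Type*} (L : Lp H 2 P →L[ℝ] U) (h : SimpleFunc Ω E)
    (y : E → H) (hy : ∫⁻ ω, ‖y (h ω)‖ₑ ^ 2 ∂P ≤ 1) :
    ∑ v ∈ h.range, ‖L (indicatorConstLpCLM P (h.measurableSet_fiber v) (y v))‖ₑ ≤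
      twoVariation P L := by
  classical
  let e := h.range.equivFin
  have hsum := sum_enorm_le_twoVariation P L (A := fun i => h ⁻¹' {(e.symm i : E)})
    (x := fun i => y (e.symm i)) (fun i => h.measurableSet_fiber _)
    (fun i j hij => by
      refine Disjoint.preimage _ (Set.disjoint_singleton.2 fun hh => hij ?_)
      exact e.symm.injective (Subtype.ext hh))
    (by
      refine le_trans (le_of_eq (lintegral_congr fun ω => ?_)) hy
      congr 2
      rw [Finset.sum_eq_single (e ⟨h ω, h.mem_range_self ω⟩)]
      · simp
      · intro i _ hi
        refine Set.indicator_of_notMem (fun hmem => hi ?_) _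
        rw [← Equiv.symm_apply_eq]
        exact Subtype.ext (Eq.symm hmem)
      · simp)
  refine le_trans (le_of_eq ?_) hsum
  rw [← Finset.sum_coe_sort]
  exact (Equiv.sum_comp e.symm fun v : h.range =>
    ‖L (indicatorConstLpCLM P (h.measurableSet_fiber v) (y v))‖ₑ).symm

/-- The `L²` norm of a simple density is bounded by the 2-variation norm of the operator that it
represents. -/
theorem eLpNorm_simpleFunc_le_twoVariation {E : Type*} (L : Lp H 2 P →L[ℝ] U)
    (h : SimpleFunc Ω E) (d : E → H →L[ℝ] U)
    (hL : ∀ v x, L (indicatorConstLpCLM P (h.measurableSet_fiber v) x) =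
      P.real (h ⁻¹' {v}) • d v x) :
    eLpNorm (fun ω => d (h ω)) 2 P ≤ twoVariation P L := by
  set N := eLpNorm (fun ω => d (h ω)) 2 P with hN
  rcases eq_or_ne N 0 with h0 | h0
  · rw [h0]; exact zero_le
  have hNtop : N ≠ ∞ := ((h.map d).memLp_of_isFiniteMeasure 2 P).eLpNorm_ne_top
  have hI : ∑ v ∈ h.range, ‖d v‖ₑ ^ 2 * P (h ⁻¹' {v}) = N ^ 2 := by
    have h2 : N ^ 2 = ∫⁻ ω, ‖d (h ω)‖ₑ ^ 2 ∂P := by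
      rw [hN, eLpNorm_eq_lintegral_rpow_enorm_toReal (by norm_num) (by norm_num),
        ← ENNReal.rpow_natCast, ← ENNReal.rpow_mul]
      norm_num
    rw [h2]
    have := (h.map fun v => ‖d v‖ₑ ^ 2).lintegral_eq_lintegral P
    rw [SimpleFunc.map_lintegral] at this
    exact this.symm
  have hI' : ∫⁻ ω, ‖d (h ω)‖ₑ ^ 2 ∂P = N ^ 2 := by
    rw [← hI, ← SimpleFunc.map_lintegral, ← SimpleFunc.lintegral_eq_lintegral]
    rfl
  have hc : ‖N.toReal⁻¹‖ₑ = N⁻¹ := by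
    rw [enorm_inv (ENNReal.toReal_ne_zero.2 ⟨h0, hNtop⟩), Real.enorm_of_nonneg ENNReal.toReal_nonneg,
      ENNReal.ofReal_toReal hNtop]
  -- The operator norm of `d v` need not be attained, so near-maximisers are used at the cost of a
  -- factor `θ < 1`, and `θ` tends to `1` at the end.
  have key (θ : ℝ) (hθ0 : 0 ≤ θ) (hθ1 : θ < 1) : ENNReal.ofReal θ * N ≤ twoVariation P L := by
    have hx (v : H →L[ℝ] U) : ∃ x : H, ‖x‖ ≤ 1 ∧ θ * ‖v‖ ≤ ‖v x‖ := by
      rcases eq_or_ne v 0 with rfl | hv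
      · exact ⟨0, by simp⟩
      · obtain ⟨x, hx1, hx2⟩ := v.exists_lt_apply_of_lt_opNorm
          (mul_lt_of_lt_one_left (norm_pos_iff.2 hv) hθ1)
        exact ⟨x, hx1.le, hx2.le⟩
    choose x hx1 hx2 using hx
    have hx1' (v : H →L[ℝ] U) : ‖x v‖ₑ ≤ 1 := by
      rw [← ofReal_norm, ENNReal.ofReal_le_one]; exact hx1 v
    have hx2' (v : H →L[ℝ] U) : ENNReal.ofReal θ * ‖v‖ₑ ≤ ‖v (x v)‖ₑ := by
      rw [← ofReal_norm, ← ofReal_norm, ← ENNReal.ofReal_mul hθ0]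
      exact ENNReal.ofReal_le_ofReal (hx2 v)
    -- The weights `‖d v‖ / N` are those of equality in Cauchy-Schwarz: the test function has `L²`
    -- norm at most 1, and the sum is at least `θ N⁻¹ N² = θ N`.
    refine le_trans ?_ (sum_range_enorm_le_twoVariation P L h
      (fun v => (N.toReal⁻¹ * ‖d v‖) • x (d v)) ?_)
    · calc ENNReal.ofReal θ * N = ENNReal.ofReal θ * N⁻¹ * N ^ 2 := by
            rw [pow_two, mul_assoc, ← mul_assoc N⁻¹, ENNReal.inv_mul_cancel h0 hNtop, one_mul]
        _ = ∑ v ∈ h.range, ENNReal.ofReal θ * N⁻¹ * (‖d v‖ₑ ^ 2 * P (h ⁻¹' {v})) := by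
            rw [← hI, Finset.mul_sum]
        _ ≤ _ := by
            refine Finset.sum_le_sum fun v _ => ?_
            rw [hL, map_smul, enorm_smul, enorm_smul, enorm_mul, hc, enorm_norm,
              Measure.real, Real.enorm_of_nonneg ENNReal.toReal_nonneg,
              ENNReal.ofReal_toReal (measure_ne_top _ _)]
            calc ENNReal.ofReal θ * N⁻¹ * (‖d v‖ₑ ^ 2 * P (h ⁻¹' {v}))
                = P (h ⁻¹' {v}) * (N⁻¹ * ‖d v‖ₑ * (ENNReal.ofReal θ * ‖d v‖ₑ)) := by ring
              _ ≤ _ := by gcongr; exact hx2' (d v)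
    · calc ∫⁻ ω, ‖(N.toReal⁻¹ * ‖d (h ω)‖) • x (d (h ω))‖ₑ ^ 2 ∂P
          ≤ ∫⁻ ω, (N⁻¹) ^ 2 * ‖d (h ω)‖ₑ ^ 2 ∂P := by
            refine lintegral_mono fun ω => ?_
            simp only []
            rw [enorm_smul, enorm_mul, hc, enorm_norm, ← mul_pow]
            exact pow_le_pow_left₀ zero_le (mul_le_of_le_one_right zero_le (hx1' _)) 2
        _ = 1 := by
            rw [lintegral_const_mul' _ _ (by simp [h0]), hI', ← mul_pow,
              ENNReal.inv_mul_cancel h0 hNtop, one_pow]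
  have hlim : Tendsto (fun θ : ℝ => ENNReal.ofReal θ * N) (𝓝[<] 1) (𝓝 N) := by
    have h1 : Tendsto (fun θ : ℝ => ENNReal.ofReal θ * N) (𝓝 1) (𝓝 (ENNReal.ofReal 1 * N)) :=
      ENNReal.Tendsto.mul_const ((ENNReal.continuous_ofReal.tendsto 1)) (Or.inr hNtop)
    simpa using h1.mono_left nhdsWithin_le_nhds
  refine le_of_tendsto hlim ?_
  filter_upwards [Ioo_mem_nhdsLT (zero_lt_one' ℝ)] with θ hθ
  exact key θ hθ.1.le hθ.2

end TwoVariation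

/-! ### Operators on `L²` given by densities. -/

section Representation

variable {Ω H U : Type*} [MeasurableSpace Ω] (P : Measure Ω) [IsProbabilityMeasure P]
  [NormedAddCommGroup H] [NormedSpace ℝ H] [NormedAddCommGroup U] [NormedSpace ℝ U]

/-- Cuts `C` along the finitely many fibres of `t`, because the density formula is available only
inside a single fibre. -/
theorem apply_indicator_eq_of_forall_fiber {E : Type*} {L M : Lp H 2 P →L[ℝ] U}
    (t : SimpleFunc Ω E) (x : H)
    (h : ∀ (v : E) (C : Set Ω) (hC : MeasurableSet C), C ⊆ t ⁻¹' {v} →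
      L (indicatorConstLpCLM P hC x) = M (indicatorConstLpCLM P hC x))
    {C : Set Ω} (hC : MeasurableSet C) :
    L (indicatorConstLpCLM P hC x) = M (indicatorConstLpCLM P hC x) := by
  classical
  have key : ∀ (T : Finset E) (D : Set Ω) (hD : MeasurableSet D), D ⊆ t ⁻¹' T →
      L (indicatorConstLpCLM P hD x) = M (indicatorConstLpCLM P hD x) := by
    intro T
    induction T using Finset.induction_on with
    | empty =>
      intro D hD hsub
      have : D = ∅ := by simpa using hsub
      have h0 : P D = 0 := by rw [this, measure_empty]
      rw [indicatorConstLpCLM_eq_zero P hD h0, map_zero, map_zero]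
    | insert a T _ ih =>
      intro D hD hsub
      have hfib := t.measurableSet_fiber a
      have h1 := h a (D ∩ t ⁻¹' {a}) (hD.inter hfib) Set.inter_subset_right
      have h2 := ih (D \ t ⁻¹' {a}) (hD.diff hfib) (by
        intro ω hω
        have := hsub hω.1
        simp only [Finset.coe_insert, Set.mem_preimage, Set.mem_insert_iff] at this
        exact this.resolve_left hω.2)
      have hun := indicatorConstLpCLM_union P (hD.inter hfib) (hD.diff hfib)
        (Set.disjoint_sdiff_inter.symm) x
      have hset : D ∩ t ⁻¹' {a} ∪ D \ t ⁻¹' {a} = D := Set.inter_union_sdiff D _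
      simp only [hset] at hun
      rw [hun, map_add, map_add, h1, h2]
  exact key t.range C hC fun ω _ => by simp

/-- Two continuous linear maps on `L²` agree if they agree on small step functions. -/
theorem eq_of_forall_indicator_eq {L M : Lp H 2 P →L[ℝ] U}
    (h : ∀ (C : Set Ω) (hC : MeasurableSet C) (x : H), ‖x‖ ≤ 1 →
      L (indicatorConstLpCLM P hC x) = M (indicatorConstLpCLM P hC x)) : L = M := by
  refine ContinuousLinearMap.ext fun Y => ?_
  induction Y using Lp.induction (p := 2) ENNReal.ofNat_ne_top with
  | indicatorConst c hs hμs =>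
    rw [Lp.simpleFunc.coe_indicatorConst]
    change L (indicatorConstLpCLM P hs c) = M (indicatorConstLpCLM P hs c)
    rcases eq_or_ne c 0 with rfl | hc
    · simp
    · have h1 := h _ hs (‖c‖⁻¹ • c) (by
        rw [norm_smul, norm_inv, norm_norm, inv_mul_cancel₀ (norm_ne_zero_iff.2 hc)])
      simp only [map_smul] at h1
      exact smul_right_injective U (inv_ne_zero (norm_ne_zero_iff.2 hc)) h1
  | add hf hg _ h1 h2 => rw [map_add, map_add, h1, h2]
  | isClosed => exact isClosed_eq L.continuous M.continuous

/-- The pairing `g ↦ (Y ↦ E[g Y])` of operator valued with vector valued `L²` functions. -/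
noncomputable def operatorPairing [CompleteSpace U] :
    Lp (H →L[ℝ] U) 2 P →L[ℝ] Lp H 2 P →L[ℝ] U :=
  (ContinuousLinearMap.id ℝ (H →L[ℝ] U)).lpPairing P 2 2

omit [IsProbabilityMeasure P] in
theorem operatorPairing_apply [CompleteSpace U] (g : Lp (H →L[ℝ] U) 2 P) (Y : Lp H 2 P) :
    operatorPairing P g Y = ∫ ω, g ω (Y ω) ∂P :=
  ContinuousLinearMap.lpPairing_eq_integral _ g Y

theorem operatorPairing_indicator [CompleteSpace U] (g : Lp (H →L[ℝ] U) 2 P) {C : Set Ω}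
    (hC : MeasurableSet C) (x : H) :
    operatorPairing P g (indicatorConstLpCLM P hC x) = ∫ ω in C, g ω x ∂P := by
  rw [operatorPairing_apply, ← integral_indicator hC]
  refine integral_congr_ae ?_
  filter_upwards [indicatorConstLp_coeFn (p := 2) (hs := hC) (hμs := measure_ne_top P C)
    (c := x)] with ω h
  rw [indicatorConstLpCLM_apply, h]
  by_cases hω : ω ∈ C <;> simp [hω]

end Representation

/-! ### Existence of the regular L-derivative. -/

section Existence

variable {Ω H U : Type*} [MeasurableSpace Ω] (P : Measure Ω) [IsProbabilityMeasure P]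
  [NormedAddCommGroup H] [InnerProductSpace ℝ H] [MeasurableSpace H] [BorelSpace H]
  [NormedAddCommGroup U] [InnerProductSpace ℝ U] [CompleteSpace U]

theorem isRegularLDeriv_of_eq_operatorPairing {f : P2 H → U} (hf : Differentiable ℝ (lionsLift P f))
    {μ : P2 H} (g : Lp (H →L[ℝ] U) 2 μ.1)
    (h : ∀ (X : Lp H 2 P) (hX : lawP2 P X = μ), fderiv ℝ (lionsLift P f) X =
      operatorPairing P (Lp.compMeasurePreserving X (measurePreserving_of_lawP2_eq P hX) g)) :
    IsRegularLDeriv P f μ g := by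
  refine fun X hX => ⟨hf X, fun Y => ?_⟩
  have hcomp : Lp.compMeasurePreserving X (measurePreserving_of_lawP2_eq P hX) g =ᵐ[P] g ∘ X :=
    Lp.coeFn_compMeasurePreserving g _
  have hae : (fun ω => Lp.compMeasurePreserving X (measurePreserving_of_lawP2_eq P hX) g ω (Y ω))
      =ᵐ[P] fun ω => g (X ω) (Y ω) := by
    filter_upwards [hcomp] with ω hω
    rw [hω]; rfl
  constructor
  · refine Integrable.congr ?_ hae
    exact memLp_one_iff_integrable.1 ((ContinuousLinearMap.id ℝ (H →L[ℝ] U)).memLp_of_bilin 1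
      (Lp.memLp _) (Lp.memLp Y))
  · rw [h X hX, operatorPairing_apply]
    exact integral_congr_ae hae

/-- The derivative of the lift of an absolutely continuous L-differentiable map is represented by
a square integrable function of the state variable, which depends only on the law. -/
theorem exists_isRegularLDeriv [StandardBorelSpace Ω] [NullSingletonClass P]
    [CompleteSpace H] [SecondCountableTopology H] {f : P2 H → U} (hf : AbsContLDiff P f)
    (μ : P2 H) : ∃ g, IsRegularLDeriv P f μ g := by
  obtain ⟨hdiff, -, hcont⟩ := hf
  have := μ.2.1
  obtain ⟨X₀, hX₀⟩ := exists_lawP2_eq P μ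
  have hid : MemLp (fun x : H => x) 2 μ.1 := by
    refine ⟨by fun_prop, ?_⟩
    rw [eLpNorm_lt_top_iff_lintegral_rpow_enorm_lt_top (by norm_num) (by norm_num)]
    simpa using μ.2.2
  let s (n : ℕ) : SimpleFunc H H := SimpleFunc.approxOn (fun x : H => x) measurable_id
    (Set.range (fun x : H => x) ∪ {0}) 0 (by simp) n
  let S (n : ℕ) : Lp H 2 μ.1 := ((s n).memLp_of_isFiniteMeasure 2 μ.1).toLp
  have hS : Tendsto S atTop (𝓝 hid.toLp) :=
    SimpleFunc.tendsto_approxOn_range_Lp (by norm_num) measurable_id hid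
  choose m hm using fun n => exists_fderiv_lionsLift_simpleFunc P hdiff μ (s n) (S n)
    (MemLp.coeFn_toLp _)
  let G (n : ℕ) : Lp (H →L[ℝ] U) 2 μ.1 :=
    (((s n).map (m n)).memLp_of_isFiniteMeasure 2 μ.1).toLp
  have hrep (n : ℕ) (X : Lp H 2 P) (hX : lawP2 P X = μ) : fderiv ℝ (lionsLift P f)
      (Lp.compMeasurePreserving X (measurePreserving_of_lawP2_eq P hX) (S n)) =
      operatorPairing P
        (Lp.compMeasurePreserving X (measurePreserving_of_lawP2_eq P hX) (G n)) := by
    refine eq_of_forall_indicator_eq P fun C hC x _ => ?_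
    refine apply_indicator_eq_of_forall_fiber P
      ((s n).comp X (measurePreserving_of_lawP2_eq P hX).measurable) x ?_ hC
    intro v C hC hCv
    rw [hm n X hX v C hC hCv x, operatorPairing_indicator, ← setIntegral_const]
    have hG : Lp.compMeasurePreserving X (measurePreserving_of_lawP2_eq P hX) (G n) =ᵐ[P]
        fun ω => m n (s n (X ω)) :=
      (Lp.coeFn_compMeasurePreserving _ _).trans
        ((measurePreserving_of_lawP2_eq P hX).quasiMeasurePreserving.ae_eq_comp
          (MemLp.coeFn_toLp _))
    refine setIntegral_congr_ae hC ?_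
    filter_upwards [hG] with ω hω hωC
    have hv : s n (X ω) = v := hCv hωC
    rw [hω, hv]
  have hedist (n k : ℕ) : edist (G n) (G k) ≤ twoVariation P
      (fderiv ℝ (lionsLift P f)
        (Lp.compMeasurePreserving X₀ (measurePreserving_of_lawP2_eq P hX₀) (S n)) -
      fderiv ℝ (lionsLift P f)
        (Lp.compMeasurePreserving X₀ (measurePreserving_of_lawP2_eq P hX₀) (S k))) := by
    rw [Lp.edist_toLp_toLp, ← eLpNorm_comp_measurePreserving
      (((s n).map (m n)).aestronglyMeasurable.sub ((s k).map (m k)).aestronglyMeasurable)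
      (measurePreserving_of_lawP2_eq P hX₀)]
    -- The pair of simple functions is a common refinement: on each of its fibres both densities are
    -- constant.
    refine eLpNorm_simpleFunc_le_twoVariation P _
      (((s n).pair (s k)).comp X₀ (measurePreserving_of_lawP2_eq P hX₀).measurable)
      (fun p => m n p.1 - m k p.2) fun v x => ?_
    have hfib (ω : Ω) (hω : ω ∈ ((s n).pair (s k)).comp X₀
        (measurePreserving_of_lawP2_eq P hX₀).measurable ⁻¹' {v}) :
        s n (X₀ ω) = v.1 ∧ s k (X₀ ω) = v.2 :=
      ⟨congrArg Prod.fst hω, congrArg Prod.snd hω⟩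
    rw [sub_apply, hm n X₀ hX₀ v.1 _ _ (fun ω hω => (hfib ω hω).1) x,
      hm k X₀ hX₀ v.2 _ _ (fun ω hω => (hfib ω hω).2) x, sub_apply, smul_sub]
  have hSX (X : Lp H 2 P) (hX : lawP2 P X = μ) : Tendsto (fun n => twoVariation P
      (fderiv ℝ (lionsLift P f)
        (Lp.compMeasurePreserving X (measurePreserving_of_lawP2_eq P hX) (S n)) -
      fderiv ℝ (lionsLift P f) X)) atTop (𝓝 0) := by
    refine (hcont X).comp ?_
    have h1 := ((Lp.isometry_compMeasurePreserving (E := H) (p := 2)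
      (measurePreserving_of_lawP2_eq P hX)).continuous.tendsto hid.toLp).comp hS
    have h2 : Lp.compMeasurePreserving X (measurePreserving_of_lawP2_eq P hX) hid.toLp = X := by
      refine Lp.ext ((Lp.coeFn_compMeasurePreserving _ _).trans ?_)
      exact (measurePreserving_of_lawP2_eq P hX).quasiMeasurePreserving.ae_eq_comp
        hid.coeFn_toLp
    rwa [h2] at h1
  have hcauchy : CauchySeq G := by
    rw [EMetric.cauchySeq_iff]
    intro ε hε
    have hε2 : 0 < ε / 2 := ENNReal.half_pos hε.ne'
    obtain ⟨N, hN⟩ := eventually_atTop.1 ((hSX X₀ hX₀).eventually_lt_const hε2)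
    refine ⟨N, fun n hn k hk => (hedist n k).trans_lt ?_⟩
    have h := twoVariation_add_le P
      (fderiv ℝ (lionsLift P f)
        (Lp.compMeasurePreserving X₀ (measurePreserving_of_lawP2_eq P hX₀) (S n)) -
        fderiv ℝ (lionsLift P f) X₀)
      (fderiv ℝ (lionsLift P f) X₀ - fderiv ℝ (lionsLift P f)
        (Lp.compMeasurePreserving X₀ (measurePreserving_of_lawP2_eq P hX₀) (S k)))
    rw [sub_add_sub_cancel, twoVariation_sub_comm P (fderiv ℝ (lionsLift P f) X₀)] at h
    exact h.trans_lt (ENNReal.add_halves ε ▸ ENNReal.add_lt_add (hN n hn) (hN k hk))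
  obtain ⟨g, hg⟩ := cauchySeq_tendsto_of_complete hcauchy
  -- The Cauchy property was checked at `X₀` alone, but the `G n` represent the derivative at `s n
  -- (X)` for every `X` with law `μ`, so the limit serves all of them.
  refine ⟨g, isRegularLDeriv_of_eq_operatorPairing P hdiff g fun X hX => ?_⟩
  refine eq_of_forall_indicator_eq P fun C hC x hx => ?_
  have hlim1 : Tendsto (fun n => fderiv ℝ (lionsLift P f)
      (Lp.compMeasurePreserving X (measurePreserving_of_lawP2_eq P hX) (S n))
      (indicatorConstLpCLM P hC x)) atTop
      (𝓝 (fderiv ℝ (lionsLift P f) X (indicatorConstLpCLM P hC x))) := by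
    rw [tendsto_iff_edist_tendsto_0]
    refine tendsto_of_tendsto_of_tendsto_of_le_of_le tendsto_const_nhds (hSX X hX)
      (fun n => zero_le) fun n => ?_
    rw [edist_eq_enorm_sub, ← sub_apply]
    exact enorm_apply_indicator_le_twoVariation P _ hC hx
  have hlim2 : Tendsto (fun n => operatorPairing P
      (Lp.compMeasurePreserving X (measurePreserving_of_lawP2_eq P hX) (G n))
      (indicatorConstLpCLM P hC x)) atTop
      (𝓝 (operatorPairing P
        (Lp.compMeasurePreserving X (measurePreserving_of_lawP2_eq P hX) g)
        (indicatorConstLpCLM P hC x))) := by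
    have h1 := ((Lp.isometry_compMeasurePreserving (E := H →L[ℝ] U) (p := 2)
      (measurePreserving_of_lawP2_eq P hX)).continuous.tendsto g).comp hg
    have h2 := ((operatorPairing (H := H) (U := U) P).flip
      (indicatorConstLpCLM P hC x)).continuous.tendsto
      (Lp.compMeasurePreserving X (measurePreserving_of_lawP2_eq P hX) g)
    exact h2.comp h1
  refine tendsto_nhds_unique hlim1 (hlim2.congr fun n => ?_)
  rw [hrep n X hX]

omit [CompleteSpace U] in
theorem isRegularLDeriv_regularLDeriv {f : P2 H → U} {μ : P2 H}
    (h : ∃ g, IsRegularLDeriv P f μ g) : IsRegularLDeriv P f μ (regularLDeriv P f μ) := by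
  rw [regularLDeriv, dif_pos h]
  exact h.choose_spec

end Existence

/-! ### Scalar projections and uniqueness of the density. -/

theorem inner_riesz {H : Type*} [NormedAddCommGroup H] [InnerProductSpace ℝ H] [CompleteSpace H]
    (l : H →L[ℝ] ℝ) (w : H) : ⟪riesz l, w⟫_ℝ = l w :=
  InnerProductSpace.toDual_symm_apply

theorem riesz_innerSL_comp {H U : Type*} [NormedAddCommGroup H] [InnerProductSpace ℝ H]
    [CompleteSpace H] [NormedAddCommGroup U] [InnerProductSpace ℝ U] [CompleteSpace U]
    (v : U) (T : H →L[ℝ] U) :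
    riesz ((innerSL ℝ v).comp T) = ContinuousLinearMap.adjoint T v := by
  refine ext_inner_right ℝ fun w => ?_
  rw [inner_riesz, ContinuousLinearMap.adjoint_inner_left]
  rfl

section Projection

variable {Ω H U : Type*} [MeasurableSpace Ω] (P : Measure Ω) [IsProbabilityMeasure P]
  [NormedAddCommGroup H] [InnerProductSpace ℝ H] [MeasurableSpace H] [BorelSpace H]
  [NormedAddCommGroup U] [InnerProductSpace ℝ U]

omit [InnerProductSpace ℝ H] in
theorem lionsLift_scalarProj (f : P2 H → U) (v : U) :
    lionsLift P (scalarProj f v) = fun X => innerSL ℝ v (lionsLift P f X) :=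
  funext fun _ => real_inner_comm _ _

theorem fderiv_lionsLift_scalarProj {f : P2 H → U} {X : Lp H 2 P}
    (hf : DifferentiableAt ℝ (lionsLift P f) X) (v : U) :
    fderiv ℝ (lionsLift P (scalarProj f v)) X =
      (innerSL ℝ v).comp (fderiv ℝ (lionsLift P f) X) := by
  rw [lionsLift_scalarProj]
  exact ((innerSL ℝ v).hasFDerivAt.comp X hf.hasFDerivAt).fderiv

theorem differentiableAt_lionsLift_scalarProj {f : P2 H → U} {X : Lp H 2 P}
    (hf : DifferentiableAt ℝ (lionsLift P f) X) (v : U) :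
    DifferentiableAt ℝ (lionsLift P (scalarProj f v)) X := by
  rw [lionsLift_scalarProj]
  exact (innerSL ℝ v).differentiableAt.comp X hf

theorem AbsContLDiff.scalarProj {f : P2 H → U} (hf : AbsContLDiff P f) (v : U) :
    AbsContLDiff P (scalarProj f v) := by
  obtain ⟨hdiff, hfin, hcont⟩ := hf
  refine ⟨fun X => differentiableAt_lionsLift_scalarProj P (hdiff X) v, fun X => ?_, fun X => ?_⟩
  · rw [fderiv_lionsLift_scalarProj P (hdiff X)]
    exact (twoVariation_comp_le P _ _).trans_lt (ENNReal.mul_lt_top enorm_lt_top (hfin X))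
  · have hlim : Tendsto (fun X' => ‖innerSL ℝ v‖ₑ *
        twoVariation P (fderiv ℝ (lionsLift P f) X' - fderiv ℝ (lionsLift P f) X)) (𝓝 X)
        (𝓝 0) := by
      simpa using ENNReal.Tendsto.const_mul (hcont X) (Or.inr enorm_ne_top)
    refine tendsto_of_tendsto_of_tendsto_of_le_of_le tendsto_const_nhds hlim
      (fun _ => zero_le) fun X' => ?_
    simp only
    rw [fderiv_lionsLift_scalarProj P (hdiff X), fderiv_lionsLift_scalarProj P (hdiff X'),
      ← ContinuousLinearMap.comp_sub]
    exact twoVariation_comp_le P _ _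

theorem IsRegularLDeriv.scalarProj [CompleteSpace U] {f : P2 H → U} {μ : P2 H}
    {g : Lp (H →L[ℝ] U) 2 μ.1} (hg : IsRegularLDeriv P f μ g) (v : U) :
    IsRegularLDeriv P (scalarProj f v) μ
      ((ContinuousLinearMap.compL ℝ H U ℝ (innerSL ℝ v)).compLp g) := by
  intro X hX
  obtain ⟨hdiff, h⟩ := hg X hX
  refine ⟨differentiableAt_lionsLift_scalarProj P hdiff v, fun Y => ?_⟩
  obtain ⟨hint, heq⟩ := h Y
  have hae : (fun ω => innerSL ℝ v (g (X ω) (Y ω))) =ᵐ[P] fun ω =>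
      (ContinuousLinearMap.compL ℝ H U ℝ (innerSL ℝ v)).compLp g (X ω) (Y ω) := by
    filter_upwards [(measurePreserving_of_lawP2_eq P hX).quasiMeasurePreserving.ae
      ((ContinuousLinearMap.compL ℝ H U ℝ (innerSL ℝ v)).coeFn_compLp g)] with ω hω
    rw [hω]; rfl
  refine ⟨((innerSL ℝ v).integrable_comp hint).congr hae, ?_⟩
  rw [fderiv_lionsLift_scalarProj P hdiff, ContinuousLinearMap.comp_apply, heq,
    ← integral_congr_ae hae, (innerSL ℝ v).integral_comp_comm hint]

/-- The directions `1_{X ∈ A} x` determine all integrals of `g · x` over Borel sets `A`, hence `g ·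
x` almost everywhere. A dense sequence of `x` keeps the exceptional set null, and continuity of the
operators gives the remaining `x`. -/
theorem IsRegularLDeriv.unique [StandardBorelSpace Ω] [NullSingletonClass P]
    [CompleteSpace H] [SecondCountableTopology H] [CompleteSpace U] {f : P2 H → U} {μ : P2 H}
    {g g' : Lp (H →L[ℝ] U) 2 μ.1} (hg : IsRegularLDeriv P f μ g)
    (hg' : IsRegularLDeriv P f μ g') : g =ᵐ[μ.1] g' := by
  obtain ⟨X, hX⟩ := exists_lawP2_eq P μ
  have := μ.2.1
  have hmp := measurePreserving_of_lawP2_eq P hX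
  have hmap (k : H → U) (hk : AEStronglyMeasurable k μ.1) (A : Set H) (hA : MeasurableSet A) :
      ∫ y in A, k y ∂μ.1 = ∫ ω in X ⁻¹' A, k (X ω) ∂P := by
    rw [← hmp.map_eq] at hk ⊢
    exact setIntegral_map hA hk hmp.measurable.aemeasurable
  have hset (g : Lp (H →L[ℝ] U) 2 μ.1) (hg : IsRegularLDeriv P f μ g) (x : H) (A : Set H)
      (hA : MeasurableSet A) : ∫ y in A, g y x ∂μ.1 =
      fderiv ℝ (lionsLift P f) X (indicatorConstLpCLM P (hmp.measurable hA) x) := by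
    rw [((hg X hX).2 _).2]
    rw [hmap (fun y => g y x) ((Lp.aestronglyMeasurable g).apply_continuousLinearMap x) A hA,
      ← integral_indicator (hmp.measurable hA)]
    refine integral_congr_ae ?_
    filter_upwards [indicatorConstLp_coeFn (p := 2) (hs := hmp.measurable hA)
      (hμs := measure_ne_top P _) (c := x)] with ω h
    rw [indicatorConstLpCLM_apply, h]
    by_cases hω : ω ∈ X ⁻¹' A <;> simp [hω]
  have hint (g : Lp (H →L[ℝ] U) 2 μ.1) (x : H) : Integrable (fun y => g y x) μ.1 :=
    ((Lp.memLp g).integrable (by norm_num)).apply_continuousLinearMap x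
  have hae : ∀ᵐ y ∂μ.1, ∀ n, g y (TopologicalSpace.denseSeq H n) =
      g' y (TopologicalSpace.denseSeq H n) := ae_all_iff.2 fun n =>
    Integrable.ae_eq_of_forall_setIntegral_eq _ _ (hint g _) (hint g' _) fun A hA _ => by
      rw [hset g hg _ A hA, hset g' hg' _ A hA]
  filter_upwards [hae] with y hy
  refine ContinuousLinearMap.coeFn_injective ?_
  exact (TopologicalSpace.denseRange_denseSeq H).equalizer (g y).continuous (g' y).continuous
    (funext hy)

theorem regularLDeriv_scalarProj_ae_eq [StandardBorelSpace Ω] [NullSingletonClass P]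
    [CompleteSpace H] [SecondCountableTopology H] [CompleteSpace U] {f : P2 H → U}
    (hf : AbsContLDiff P f) (μ : P2 H) (v : U) :
    ∀ᵐ y ∂μ.1, regularLDeriv P (scalarProj f v) μ y =
      (innerSL ℝ v).comp (regularLDeriv P f μ y) := by
  have h1 := isRegularLDeriv_regularLDeriv P (exists_isRegularLDeriv P (hf.scalarProj P v) μ)
  have h2 := (isRegularLDeriv_regularLDeriv P (exists_isRegularLDeriv P hf μ)).scalarProj P v
  filter_upwards [h1.unique P h2, (ContinuousLinearMap.compL ℝ H U ℝ (innerSL ℝ v)).coeFn_compLp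
    (regularLDeriv P f μ)] with y hy hy'
  rw [hy, hy']
  rfl

end Projection

/-! ### `C²` maps and uniqueness of the continuous version. -/

section SecondOrder

theorem JointlyContinuous.clm_comp {H E F : Type*} [NormedAddCommGroup H] [MeasurableSpace H]
    [NormedAddCommGroup E] [NormedSpace ℝ E] [NormedAddCommGroup F] [NormedSpace ℝ F]
    {G : P2 H → H → E} (hG : JointlyContinuous G) (B : E →L[ℝ] F) :
    JointlyContinuous fun μ y => B (G μ y) := by
  intro μ y ε hε
  have hB : 0 < ‖B‖ + 1 := by positivity
  obtain ⟨δ, hδ, h⟩ := hG μ y (ε / (‖B‖ + 1)) (by positivity)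
  refine ⟨δ, hδ, fun ν z hν hz => ?_⟩
  rw [← map_sub]
  calc ‖B (G ν z - G μ y)‖ ≤ (‖B‖ + 1) * ‖G ν z - G μ y‖ :=
        B.le_of_opNorm_le (by linarith) _
    _ < ε := by
        have := h ν z hν hz
        rwa [lt_div_iff₀' hB] at this

variable {Ω H U : Type*} [MeasurableSpace Ω] (P : Measure Ω) [IsProbabilityMeasure P]
  [NormedAddCommGroup H] [InnerProductSpace ℝ H] [MeasurableSpace H] [BorelSpace H]
  [NormedAddCommGroup U] [InnerProductSpace ℝ U]

theorem IsC2Version.scalarProj [StandardBorelSpace Ω] [NullSingletonClass P]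
    [CompleteSpace H] [SecondCountableTopology H] [CompleteSpace U] {f : P2 H → U}
    {G : P2 H → H → H →L[ℝ] U} (hG : IsC2Version P f G) (v : U) :
    IsC2Version P (scalarProj f v) fun μ y => (innerSL ℝ v).comp (G μ y) := by
  have hderiv (μ : P2 H) (y : H) := (ContinuousLinearMap.compL ℝ H U ℝ (innerSL ℝ v)).hasFDerivAt.comp
    y (hG.differentiable μ y).hasFDerivAt
  refine ⟨hG.absContLDiff.scalarProj P v, fun μ => ?_,
    hG.continuous.clm_comp (ContinuousLinearMap.compL ℝ H U ℝ (innerSL ℝ v)),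
    fun μ y => (hderiv μ y).differentiableAt, ?_⟩
  · filter_upwards [hG.version μ, regularLDeriv_scalarProj_ae_eq P hG.absContLDiff μ v]
      with y h1 h2
    rw [h1, h2]
  · let B : (H →L[ℝ] H →L[ℝ] U) →L[ℝ] (H →L[ℝ] H →L[ℝ] ℝ) :=
      ContinuousLinearMap.compL ℝ H (H →L[ℝ] U) (H →L[ℝ] ℝ)
        (ContinuousLinearMap.compL ℝ H U ℝ (innerSL ℝ v))
    have h := JointlyContinuous.clm_comp (E := H →L[ℝ] H →L[ℝ] U)
      (F := H →L[ℝ] H →L[ℝ] ℝ) hG.continuous_deriv B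
    convert h using 3 with μ y
    exact (hderiv μ y).fderiv

omit [InnerProductSpace ℝ H] in
/-- Every measure in `P2 H` is a limit of measures that charge a given point. -/
theorem exists_W2_lt_measure_singleton_ne_zero [SecondCountableTopology H] (μ : P2 H) (y : H)
    {δ : ℝ} (hδ : 0 < δ) :
    ∃ ν : P2 H, W2 ν μ < ENNReal.ofReal δ ∧ ν.1 {y} ≠ 0 := by
  have := μ.2.1
  set c : ℝ≥0∞ := ∫⁻ x, ‖y - x‖ₑ ^ 2 ∂μ.1 with hc_def
  have hc : c ≠ ∞ := by
    have hid : MemLp (fun x : H => x) 2 μ.1 := by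
      refine ⟨by fun_prop, ?_⟩
      rw [eLpNorm_lt_top_iff_lintegral_rpow_enorm_lt_top (by norm_num) (by norm_num)]
      simpa using μ.2.2
    have h := ((memLp_const y).sub hid).eLpNorm_lt_top
    rw [eLpNorm_lt_top_iff_lintegral_rpow_enorm_lt_top (by norm_num) (by norm_num)] at h
    simpa [hc_def] using h.ne
  have hlim : Tendsto (fun t : ℝ≥0∞ => (t * c) ^ (1 / 2 : ℝ)) (𝓝[>] 0) (𝓝 0) := by
    have h1 : Tendsto (fun t : ℝ≥0∞ => t * c) (𝓝 0) (𝓝 (0 * c)) :=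
      ENNReal.Tendsto.mul_const tendsto_id (Or.inr hc)
    have h2 := (ENNReal.continuous_rpow_const (y := 1 / 2)).tendsto (0 * c)
    have h3 := (h2.comp h1).mono_left (nhdsWithin_le_nhds (s := Set.Ioi 0))
    simpa [Function.comp_def] using h3
  obtain ⟨t, ht, ht0, ht1⟩ := ((hlim.eventually_lt_const (ENNReal.ofReal_pos.2 hδ)).and
    (Ioo_mem_nhdsGT (zero_lt_one' ℝ≥0∞))).exists
  have ht1' : 1 - t + t = 1 := tsub_add_cancel_of_le ht1.le
  let ν : Measure H := (1 - t) • μ.1 + t • Measure.dirac y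
  have hν : IsProbabilityMeasure ν := ⟨by simp [ν, ht1']⟩
  have hν2 : ∫⁻ x, ‖x‖ₑ ^ 2 ∂ν < ∞ := by
    rw [lintegral_add_measure, lintegral_smul_measure, lintegral_smul_measure,
      lintegral_dirac' _ (by fun_prop)]
    exact ENNReal.add_lt_top.2 ⟨ENNReal.mul_lt_top (tsub_le_self.trans_lt ENNReal.one_lt_top)
      μ.2.2, ENNReal.mul_lt_top (ht1.trans ENNReal.one_lt_top) (by finiteness)⟩
  refine ⟨⟨ν, hν, hν2⟩, lt_of_le_of_lt ?_ ht, ?_⟩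
  · refine ENNReal.rpow_le_rpow ?_ (by norm_num)
    -- This coupling leaves mass `1 - t` in place and sends a fraction `t` of `μ` to `y`, so its
    -- cost is `t * c`.
    let π : Measure (H × H) := (1 - t) • μ.1.map (fun x => (x, x)) + t • μ.1.map (fun x => (y, x))
    have hm1 : Measurable fun x : H => (x, x) := by fun_prop
    have hm2 : Measurable fun x : H => (y, x) := by fun_prop
    refine iInf_le_of_le π (iInf_le_of_le ?_ (iInf_le_of_le ?_ ?_))
    · simp only [π, ν]
      rw [Measure.map_add _ _ measurable_fst, Measure.map_smul, Measure.map_smul,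
        Measure.map_map measurable_fst hm1, Measure.map_map measurable_fst hm2]
      change (1 - t) • μ.1.map id + t • μ.1.map (fun _ => y) = _
      simp
    · simp only [π]
      rw [Measure.map_add _ _ measurable_snd, Measure.map_smul, Measure.map_smul,
        Measure.map_map measurable_snd hm1, Measure.map_map measurable_snd hm2]
      change (1 - t) • μ.1.map id + t • μ.1.map id = _
      rw [Measure.map_id, ← add_smul, ht1', one_smul]
    · rw [lintegral_add_measure, lintegral_smul_measure, lintegral_smul_measure,
        lintegral_map (by fun_prop) hm1, lintegral_map (by fun_prop) hm2]
      simp [hc_def]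
  · simp [ν, ht0.ne']

/-- Almost everywhere equality under `μ` says nothing off the support of `μ`. Nearby measures with
an atom at `y` force the two versions to agree at `y`, and joint continuity carries this back to
`μ`. -/
theorem IsC2Version.unique [SecondCountableTopology H] {f : P2 H → U}
    {G G' : P2 H → H → H →L[ℝ] U}
    (hG : IsC2Version P f G) (hG' : IsC2Version P f G') : G = G' := by
  funext μ y
  by_contra hne
  have hε : 0 < ‖G μ y - G' μ y‖ / 2 := half_pos (norm_pos_iff.2 (sub_ne_zero.2 hne))
  obtain ⟨δ, hδ, h⟩ := hG.continuous μ y _ hε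
  obtain ⟨δ', hδ', h'⟩ := hG'.continuous μ y _ hε
  obtain ⟨ν, hν, hνy⟩ := exists_W2_lt_measure_singleton_ne_zero μ y (lt_min hδ hδ')
  have heq : G ν y = G' ν y := by
    have hae : ∀ᵐ x ∂ν.1, G ν x = G' ν x := by
      filter_upwards [hG.version ν, hG'.version ν] with x h1 h2
      rw [h1, h2]
    by_contra hy
    exact hνy (measure_mono_null (Set.singleton_subset_iff.2 hy) (ae_iff.1 hae))
  have h1 := h ν y (hν.trans_le (ENNReal.ofReal_le_ofReal (min_le_left _ _))) (by simpa)
  have h2 := h' ν y (hν.trans_le (ENNReal.ofReal_le_ofReal (min_le_right _ _))) (by simpa)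
  rw [heq, norm_sub_rev] at h1
  have h3 := norm_sub_le_norm_sub_add_norm_sub (G μ y) (G' ν y) (G' μ y)
  linarith

end SecondOrder

/-! ### The main theorem. -/

theorem lemma3p3 {Ω H U ι : Type*} [MeasurableSpace Ω] [StandardBorelSpace Ω]
    (P : Measure Ω) [IsProbabilityMeasure P] [NullSingletonClass P]
    [NormedAddCommGroup H] [InnerProductSpace ℝ H] [CompleteSpace H]
    [SecondCountableTopology H] [MeasurableSpace H] [BorelSpace H]
    [NormedAddCommGroup U] [InnerProductSpace ℝ U] [CompleteSpace U]
    [SecondCountableTopology U]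
    [Countable ι] (φ : HilbertBasis ι ℝ U)
    (f : P2 H → U) (hf : AbsContLDiff P f) :
    -- the projections are L-differentiable everywhere, and again absolutely continuous
    (∀ v : U, (∀ μ₀ : P2 H, LDifferentiableAt P (scalarProj f v) μ₀) ∧
      AbsContLDiff P (scalarProj f v)) ∧
    -- the regular L-derivatives exist, for `f` and for the projections
    (∀ μ₀ : P2 H, IsRegularLDeriv P f μ₀ (regularLDeriv P f μ₀) ∧
      ∀ v : U, IsRegularLDeriv P (scalarProj f v) μ₀ (regularLDeriv P (scalarProj f v) μ₀)) ∧
    -- the projection formula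
    (∀ (μ₀ : P2 H) (v : U), ∀ᵐ y ∂μ₀.1,
      riesz (regularLDeriv P (scalarProj f v) μ₀ y) =
        ContinuousLinearMap.adjoint (regularLDeriv P f μ₀ y) v) ∧
    -- the componentwise series
    (∀ μ₀ : P2 H, ∀ᵐ y ∂μ₀.1, ∀ w : H,
      (∀ i, ⟪riesz (regularLDeriv P (scalarProj f (φ i)) μ₀ y), w⟫_ℝ =
        ⟪φ i, regularLDeriv P f μ₀ y w⟫_ℝ) ∧
      HasSum (fun i => ⟪riesz (regularLDeriv P (scalarProj f (φ i)) μ₀ y), w⟫_ℝ • φ i)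
        (regularLDeriv P f μ₀ y w)) ∧
    -- the second derivative
    (IsC2 P f → ∀ v : U, IsC2 P (scalarProj f v) ∧
      ∀ G Gv, IsC2Version P f G → IsC2Version P (scalarProj f v) Gv →
        ∀ (μ : P2 H) (y z : H),
          riesz (fderiv ℝ (Gv μ) y z) =
            ContinuousLinearMap.adjoint (fderiv ℝ (G μ) y z) v) := by
  refine ⟨fun v => ⟨fun μ₀ => ?_, hf.scalarProj P v⟩, fun μ₀ =>
    ⟨isRegularLDeriv_regularLDeriv P (exists_isRegularLDeriv P hf μ₀), fun v =>
      isRegularLDeriv_regularLDeriv P (exists_isRegularLDeriv P (hf.scalarProj P v) μ₀)⟩,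
    fun μ₀ v => ?_, fun μ₀ => ?_, fun ⟨G₀, hG₀⟩ v => ⟨⟨_, hG₀.scalarProj P v⟩, ?_⟩⟩
  · obtain ⟨X, hX⟩ := exists_lawP2_eq P μ₀
    exact ⟨X, hX, (hf.scalarProj P v).1 X⟩
  · filter_upwards [regularLDeriv_scalarProj_ae_eq P hf μ₀ v] with y hy
    rw [hy, riesz_innerSL_comp]
  -- Countability of the basis yields one null set for all `i`; it does not depend on `w`, since the
  -- identity is one of operators.
  · filter_upwards [ae_all_iff.2 fun i => regularLDeriv_scalarProj_ae_eq P hf μ₀ (φ i)]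
      with y hy w
    have h (i : ι) : ⟪riesz (regularLDeriv P (scalarProj f (φ i)) μ₀ y), w⟫_ℝ =
        ⟪φ i, regularLDeriv P f μ₀ y w⟫_ℝ := by
      rw [hy i, inner_riesz]
      rfl
    refine ⟨h, ?_⟩
    simpa only [h, φ.repr_apply_apply] using φ.hasSum_repr (regularLDeriv P f μ₀ y w)
  · intro G Gv hG hGv μ y z
    -- By uniqueness the given version of the derivative of `f_v` is `G` followed by `⟪v, ·⟫`, so
    -- the claim is the chain rule at every point.
    obtain rfl := hGv.unique P (hG.scalarProj P v)
    have hderiv := (ContinuousLinearMap.compL ℝ H U ℝ (innerSL ℝ v)).hasFDerivAt.comp y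
      (hG.differentiable μ y).hasFDerivAt
    rw [← riesz_innerSL_comp]
    exact congrArg (fun T => riesz (T z)) hderiv.fderiv
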